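/- A *convex body* is a bounded convex set $C\subset\mathbb{R}^2$ with non-empty interior. For an angle $\theta\in\mathbb{R}/2\pi\mathbb{Z}$ put $\mathbf u(\theta)=(\cos\theta,\sin\theta)$, and for $\lambda\ge 0$ let $$K_C(\theta,\lambda)=\Big\{\mathbf x\in C:\ \mathbf x\cdot\mathbf u(\theta)=\inf_{\mathbf y\in C}\mathbf y\cdot\mathbf u(\theta)+\lambda\Big\}$$ be the chord of $C$ in direction $\mathbf u(\theta)$ at distance $\lambda$, with length $|K_C(\theta,\lambda)|$. Put $$\gamma_C(\theta,\lambda)=\max\{|K_C(\theta,\lambda)|,|K_C(\theta+\pi,\lambda)|\},\qquad L_C=\sup_{\mathbf x,\mathbf y\in C}|\mathbf x-\mathbf y|,\qquad S_C=\inf_{\theta}\ \sup_{\lambda\ge 0}|K_C(\theta,\lambda)|.$$ For a bounded set $\Omega\subset\mathbb{R}^2$ let $\widehat{\mathbf 1}_\Omega(\boldsymbol\xi)=\int_\Omega e^{-2\pi i\,\mathbf x\cdot\boldsymbol\xi}\,d\mathbf x$, and let $\delta C=\{\delta\mathbf x:\mathbf x\in C\}$ for $\delta\ge 0$. **Lemma.**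 There exist positive absolute constants $\kappa_3,\kappa_4$ such that, for every convex body $C\subset\mathbb{R}^2$, every angle $\theta\in\mathbb{R}/2\pi\mathbb{Z}$ and every real $\rho\ge\kappa_3L_C^6/S_C^7$, the function $\delta\mapsto|\widehat{\mathbf 1}_{\delta C}(\rho\,\mathbf u(\theta))|^2$ is integrable on $[0,1]$ and $$\kappa_4\,\rho^{-2}\gamma_C(\theta,\rho^{-1})^2\ \le\ \int_0^1\big|\widehat{\mathbf 1}_{\delta C}(\rho\,\mathbf u(\theta))\big|^2\,d\delta\ \le\ 2\,\rho^{-2}\gamma_C(\theta,\rho^{-1})^2 .$$ -/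

import Mathlib

open scoped Pointwise FourierTransform RealInnerProductSpace

noncomputable section

namespace PlanarBody

/-- The Euclidean plane. -/
abbrev Plane : Type := EuclideanSpace ℝ (Fin 2)

/-- A planar convex body: a bounded convex subset of the plane with non-empty interior. -/
structure IsConvexBody (C : Set Plane) : Prop where
  convex : Convex ℝ C
  isBounded : Bornology.IsBounded C
  interior_nonempty : (interior C).Nonempty

/-- The unit vector `(cos θ, sin θ)`, for an angle `θ` in `ℝ / 2πℤ`. -/
def u (θ : Real.Angle) : Plane := !₂[θ.cos, θ.sin]

/-- The chord of `C` in direction `u θ` at distance `l` from the supporting line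
`x · u θ = inf_{y ∈ C} y · u θ`. -/
def chord (C : Set Plane) (θ : Real.Angle) (l : ℝ) : Set Plane :=
  {x | x ∈ C ∧ ⟪x, u θ⟫ = (⨅ y : C, ⟪(y : Plane), u θ⟫) + l}

/-- The length of the chord. A chord of a convex set is a (possibly empty) line segment, with or
without its endpoints, so that its length is its diameter. -/
def chordLength (C : Set Plane) (θ : Real.Angle) (l : ℝ) : ℝ :=
  Metric.diam (chord C θ l)

/-- The longer of the two chords at distance `l` in the directions `θ` and `θ + π`. -/
def gamma (C : Set Plane) (θ : Real.Angle) (l : ℝ) : ℝ :=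
  max (chordLength C θ l) (chordLength C (θ + (Real.pi : Real.Angle)) l)

/-- The longest directional diameter, that is, the usual diameter. -/
def longDiam (C : Set Plane) : ℝ := Metric.diam C

/-- The shortest directional diameter: the least, over all directions, of the length of the
longest chord in that direction. -/
def shortDiam (C : Set Plane) : ℝ :=
  ⨅ θ : Real.Angle, ⨆ l : {l : ℝ // 0 ≤ l}, chordLength C θ l

/-- The Fourier transform `ξ ↦ ∫_Ω exp (-2πi x · ξ) dx` of the indicator function of `Ω`. -/
def indicatorFourier (Ω : Set Plane) (ξ : Plane) : ℂ :=
  𝓕 (Ω.indicator (fun _ => (1 : ℂ))) ξ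

end PlanarBody

end

/-!
Integrating along the lines orthogonal to `u θ` turns the Fourier transform of `1_C` at `s • u θ`
into the one-dimensional transform at `s` of the chord length, which by Brunn–Minkowski is a concave
function `f` on an interval. After rescaling, `ρ = 1`, the interval is `(0, w)` with `w` large, and
`H = max (f 1) (f (w - 1))` is to be compared with the `L²` norm of `δ² 𝓕 f δ` over `[0, 1]`.

Upper bound: for `h = 1 / (2δ)`, translation by `h` changes the sign of the character, so
`-4 𝓕 f δ` is the transform of the second difference of `f` with step `h`. This function has
integral zero and, by concavity, can be positive only within `h` of the two ends; its `L¹` norm is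
thus twice the integral of its positive part, of order `h` times the height of `f` near the ends.

Lower bound: there is a weight `g` on `[0, 1]` with `|g s| ≤ s²` whose Fourier transform has
positive real part on `[0, ∞)`. Since `f ≥ 0`, the integral of `δ² |𝓕 f δ|` over `[0, 1]` dominates
`∫ f · Re 𝓕 g`, which is at least a multiple of `f 1`; reflecting `f` gives `f (w - 1)`, and
Jensen's inequality passes to squares.
-/

noncomputable section

open MeasureTheory Set Filter Topology

section Fourier

variable {V : Type*} [NormedAddCommGroup V] [InnerProductSpace ℝ V] [FiniteDimensional ℝ V]
  [MeasurableSpace V] [BorelSpace V]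
  {E : Type*} [NormedAddCommGroup E] [NormedSpace ℂ E]

theorem norm_fourier_le_integral_norm (f : V → E) (ξ : V) : ‖𝓕 f ξ‖ ≤ ∫ v, ‖f v‖ :=
  VectorFourier.norm_fourierIntegral_le_integral_norm _ _ _ _ _

theorem continuous_fourier {f : V → E} (hf : Integrable f) : Continuous (𝓕 f) :=
  VectorFourier.fourierIntegral_continuous Real.continuous_fourierChar
    (innerSL ℝ).continuous₂ hf

theorem fourier_add_apply {f g : V → E} (hf : Integrable f) (hg : Integrable g) (ξ : V) :
    𝓕 (fun v ↦ f v + g v) ξ = 𝓕 f ξ + 𝓕 g ξ :=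
  congrFun (VectorFourier.fourierIntegral_add Real.continuous_fourierChar
    (innerSL ℝ).continuous₂ hf hg) ξ

theorem fourier_const_smul_apply (f : V → E) (c : ℂ) (ξ : V) :
    𝓕 (fun v ↦ c • f v) ξ = c • 𝓕 f ξ :=
  congrFun (VectorFourier.fourierIntegral_const_smul Real.fourierChar volume (innerₗ V) f c) ξ

theorem fourier_comp_add_right (f : V → E) (a ξ : V) :
    𝓕 (fun v ↦ f (v + a)) ξ = Real.fourierChar ⟪a, ξ⟫ • 𝓕 f ξ :=
  congrFun (VectorFourier.fourierIntegral_comp_add_right Real.fourierChar volume (innerₗ V) f a) ξ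

theorem fourier_comp_smul (f : V → E) {c : ℝ} (hc : c ≠ 0) (ξ : V) :
    𝓕 (fun v ↦ f (c • v)) ξ = |(c ^ Module.finrank ℝ V)⁻¹| • 𝓕 f (c⁻¹ • ξ) := by
  simp only [Real.fourier_eq]
  rw [← Measure.integral_comp_smul volume (fun v ↦ Real.fourierChar (-⟪v, c⁻¹ • ξ⟫) • f v)]
  simp only [inner_smul_left, inner_smul_right, conj_trivial, inv_mul_cancel_left₀ hc]

theorem norm_fourier_comp_sub_left (f : V → ℝ) (a ξ : V) :
    ‖𝓕 (fun v ↦ (f (a - v) : ℂ)) ξ‖ = ‖𝓕 (fun v ↦ (f v : ℂ)) ξ‖ := by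
  have conj_fourier : 𝓕 (fun v ↦ (f (-v) : ℂ)) ξ = starRingEnd ℂ (𝓕 (fun v ↦ (f v : ℂ)) ξ) := by
    rw [Real.fourier_eq, Real.fourier_eq, ← integral_conj, ← integral_neg_eq_self]
    refine integral_congr_ae (ae_of_all _ fun v ↦ ?_)
    simp [Circle.smul_def, ← Circle.coe_inv_eq_conj, AddChar.map_neg_eq_inv]
  have h := fourier_comp_add_right (fun v ↦ (f (-v) : ℂ)) (-a) ξ
  simp only [neg_add, neg_neg, neg_add_eq_sub] at h
  rw [h, Circle.norm_smul, conj_fourier, RCLike.norm_conj]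

theorem integral_mul_re_fourier_le {f : V → ℝ} {g : V → ℂ} (hf : Integrable f)
    (hg : Integrable g) :
    ∫ v, f v * (𝓕 g v).re ≤ ∫ ξ, ‖𝓕 (fun v ↦ (f v : ℂ)) ξ‖ * ‖g ξ‖ := by
  have self_adjoint : ∫ ξ, 𝓕 (fun v ↦ (f v : ℂ)) ξ * g ξ = ∫ v, (f v : ℂ) * 𝓕 g v := by
    have h := VectorFourier.integral_fourierIntegral_smul_eq_flip (μ := volume) (ν := volume)
      (L := innerₗ V) Real.continuous_fourierChar (innerSL ℝ).continuous₂ hf.ofReal hg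
    rwa [flip_innerₗ] at h
  have integrable_mul : Integrable fun v ↦ (f v : ℂ) * 𝓕 g v :=
    hf.ofReal.mul_bdd (continuous_fourier hg).aestronglyMeasurable
      (ae_of_all _ (norm_fourier_le_integral_norm g))
  calc ∫ v, f v * (𝓕 g v).re = (∫ v, (f v : ℂ) * 𝓕 g v).re := by
        simpa only [RCLike.re_eq_complex_re, Complex.re_ofReal_mul] using integral_re integrable_mul
    _ ≤ ‖∫ ξ, 𝓕 (fun v ↦ (f v : ℂ)) ξ * g ξ‖ := self_adjoint ▸ Complex.re_le_norm _
    _ ≤ ∫ ξ, ‖𝓕 (fun v ↦ (f v : ℂ)) ξ * g ξ‖ := norm_integral_le_integral_norm _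
    _ = ∫ ξ, ‖𝓕 (fun v ↦ (f v : ℂ)) ξ‖ * ‖g ξ‖ := by simp only [norm_mul]

end Fourier

theorem fourier_second_difference {f : ℝ → ℂ} (hf : Integrable f) {h : ℝ} (hh : h ≠ 0) :
    𝓕 (fun t ↦ f (t + h) + f (t - h) - 2 * f t) (1 / (2 * h)) = -4 * 𝓕 f (1 / (2 * h)) := by
  have half_period : (Real.fourierChar (2⁻¹ : ℝ) : ℂ) = -1 := by
    rw [Real.fourierChar_apply, ← Complex.exp_pi_mul_I]
    push_cast
    ring_nf
  have neg_half_period : (Real.fourierChar (-2⁻¹ : ℝ) : ℂ) = -1 := by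
    rw [AddChar.map_neg_eq_inv, Circle.coe_inv, half_period, inv_neg, inv_one]
  have inner_h : ⟪h, 1 / (2 * h)⟫ = 2⁻¹ := by
    rw [Real.inner_apply, mul_one_div, div_mul_cancel_right₀ hh]
  have right_shift : 𝓕 (fun t ↦ f (t + h)) (1 / (2 * h)) = -𝓕 f (1 / (2 * h)) := by
    rw [fourier_comp_add_right, inner_h, Circle.smul_def, half_period, neg_one_smul]
  have left_shift : 𝓕 (fun t ↦ f (t - h)) (1 / (2 * h)) = -𝓕 f (1 / (2 * h)) := by
    simp only [sub_eq_add_neg]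
    rw [fourier_comp_add_right, inner_neg_left, inner_h, Circle.smul_def, neg_half_period,
      neg_one_smul]
  have scaled : 𝓕 (fun t ↦ -2 * f t) (1 / (2 * h)) = -2 * 𝓕 f (1 / (2 * h)) :=
    fourier_const_smul_apply f (-2) _
  simp only [sub_eq_add_neg _ (2 * f _), ← neg_mul]
  rw [fourier_add_apply (f := fun t ↦ f (t + h) + f (t - h))
      ((hf.comp_add_right h).add (hf.comp_sub_right h)) (hf.const_mul (-2)),
    fourier_add_apply (hf.comp_add_right h) (hf.comp_sub_right h), right_shift, left_shift, scaled]
  ring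

theorem integrable_second_difference {f : ℝ → ℝ} (hf : Integrable f) (h : ℝ) :
    Integrable fun t ↦ f (t + h) + f (t - h) - 2 * f t :=
  ((hf.comp_add_right h).add (hf.comp_sub_right h)).sub (hf.const_mul 2)

theorem integral_second_difference {f : ℝ → ℝ} (hf : Integrable f) (h : ℝ) :
    ∫ t, (f (t + h) + f (t - h) - 2 * f t) = 0 := by
  rw [integral_sub (f := fun t ↦ f (t + h) + f (t - h))
      ((hf.comp_add_right h).add (hf.comp_sub_right h)) (hf.const_mul 2),
    integral_add (hf.comp_add_right h) (hf.comp_sub_right h), integral_const_mul,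
    integral_add_right_eq_self f h, integral_sub_right_eq_self f h]
  ring

theorem integral_abs_le_two_mul_of_le {α : Type*} [MeasurableSpace α] {μ : Measure α}
    {D B : α → ℝ} (hD : Integrable D μ) (hB : Integrable B μ) (hD0 : ∫ x, D x ∂μ = 0)
    (hDB : ∀ x, D x ≤ B x) (hB0 : ∀ x, 0 ≤ B x) : ∫ x, |D x| ∂μ ≤ 2 * ∫ x, B x ∂μ :=
  calc ∫ x, |D x| ∂μ ≤ ∫ x, (2 * B x - D x) ∂μ :=
        integral_mono hD.abs ((hB.const_mul 2).sub hD) fun x ↦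
          abs_le.2 ⟨by linarith [hB0 x], by linarith [hDB x]⟩
    _ = 2 * ∫ x, B x ∂μ := by
        rw [integral_sub (hB.const_mul 2) hD, integral_const_mul, hD0, sub_zero]

/-- A nonnegative function on the line that is concave on `(0, w)` and vanishes off this interval:
the shape of the chord lengths in a given direction of a convex body whose width in that direction
is `w`. -/
structure IsConcaveProfile (w : ℝ) (f : ℝ → ℝ) : Prop where
  concaveOn : ConcaveOn ℝ (Ioo 0 w) f
  nonneg : ∀ t, 0 ≤ f t
  eq_zero : ∀ t ∉ Ioo 0 w, f t = 0

/-- The larger of the values of `f` at distance `l` from the two ends of `[0, w]`, the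
one-dimensional counterpart of `PlanarBody.gamma`. -/
def endHeight (w : ℝ) (f : ℝ → ℝ) (l : ℝ) : ℝ := max (f l) (f (w - l))

theorem endHeight_reflect (w : ℝ) (f : ℝ → ℝ) (l : ℝ) :
    endHeight w (fun t ↦ f (w - t)) l = endHeight w f l := by
  simp only [endHeight, sub_sub_cancel, max_comm]

namespace IsConcaveProfile

variable {w : ℝ} {f : ℝ → ℝ}

theorem eq_zero_of_nonpos (hf : IsConcaveProfile w f) {t : ℝ} (ht : t ≤ 0) : f t = 0 :=
  hf.eq_zero t fun h ↦ ht.not_gt h.1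

theorem eq_zero_of_le (hf : IsConcaveProfile w f) {t : ℝ} (ht : w ≤ t) : f t = 0 :=
  hf.eq_zero t fun h ↦ ht.not_gt h.2

theorem reflect (hf : IsConcaveProfile w f) : IsConcaveProfile w fun t ↦ f (w - t) where
  concaveOn := by
    have h := hf.concaveOn.comp_affineMap (AffineMap.const ℝ ℝ w - AffineMap.id ℝ ℝ)
    change ConcaveOn ℝ ((fun t ↦ w - t) ⁻¹' Ioo 0 w) fun t ↦ f (w - t) at h
    rwa [preimage_const_sub_Ioo, sub_self, sub_zero] at h
  nonneg t := hf.nonneg _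
  eq_zero t ht := hf.eq_zero _ fun h ↦ ht ⟨by linarith [h.2], by linarith [h.1]⟩

theorem comp_inv_mul (hf : IsConcaveProfile w f) {c : ℝ} (hc : 0 < c) :
    IsConcaveProfile (w * c) fun t ↦ f (c⁻¹ * t) where
  concaveOn := by
    have h := hf.concaveOn.comp_linearMap (LinearMap.mulLeft ℝ c⁻¹)
    change ConcaveOn ℝ ((c⁻¹ * ·) ⁻¹' Ioo 0 w) fun t ↦ f (c⁻¹ * t) at h
    rwa [preimage_const_mul_Ioo₀ _ _ (inv_pos.2 hc), zero_div, div_inv_eq_mul] at h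
  nonneg t := hf.nonneg _
  eq_zero t ht := hf.eq_zero _ fun h ↦ ht <| by
    rwa [← mem_preimage (f := (c⁻¹ * ·)), preimage_const_mul_Ioo₀ _ _ (inv_pos.2 hc), zero_div,
      div_inv_eq_mul] at h

theorem mul_apply_le_mul_apply (hf : IsConcaveProfile w f) {x y : ℝ} (hx : 0 ≤ x) (hxy : x ≤ y) :
    x * f y ≤ y * f x := by
  rcases hx.eq_or_lt with rfl | hx
  · rw [zero_mul, hf.eq_zero_of_nonpos le_rfl, mul_zero]
  rcases le_or_gt w y with hy | hy
  · rw [hf.eq_zero_of_le hy, mul_zero]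
    exact mul_nonneg (hx.le.trans hxy) (hf.nonneg x)
  rcases hxy.eq_or_lt with rfl | hxy
  · rfl
  have slope_le : ∀ᶠ ε in 𝓝[>] 0, (f y - f x) * (x - ε) ≤ f x * (y - x) := by
    filter_upwards [Ioo_mem_nhdsGT hx] with ε hε
    have h := hf.concaveOn.slope_anti_adjacent ⟨hε.1, by linarith [hε.2]⟩ ⟨by linarith, hy⟩ hε.2 hxy
    rw [div_le_div_iff₀ (by linarith) (by linarith [hε.2])] at h
    nlinarith [hf.nonneg ε]
  have tendsto_slope : Tendsto (fun ε ↦ (f y - f x) * (x - ε)) (𝓝[>] 0)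
      (𝓝 ((f y - f x) * (x - 0))) :=
    (Continuous.tendsto (by fun_prop) 0).mono_left nhdsWithin_le_nhds
  linarith [le_of_tendsto tendsto_slope slope_le]

theorem sub_mul_apply_le_sub_mul_apply (hf : IsConcaveProfile w f) {x y : ℝ} (hxy : x ≤ y)
    (hy : y ≤ w) : (w - y) * f x ≤ (w - x) * f y := by
  simpa using hf.reflect.mul_apply_le_mul_apply (sub_nonneg.2 hy) (sub_le_sub_left hxy w)

theorem apply_add_le (hf : IsConcaveProfile w f) {x y : ℝ} (hx : 0 < x) (hy : 0 < y) :
    f (x + y) ≤ f x + f y := by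
  have hfx := hf.mul_apply_le_mul_apply hx.le (by linarith : x ≤ x + y)
  have hfy := hf.mul_apply_le_mul_apply hy.le (by linarith : y ≤ x + y)
  exact le_of_mul_le_mul_left (by linarith) (add_pos hx hy)

theorem endHeight_nonneg (hf : IsConcaveProfile w f) (l : ℝ) : 0 ≤ endHeight w f l :=
  le_max_of_le_left (hf.nonneg l)

theorem mul_endHeight_le (hf : IsConcaveProfile w f) {l h : ℝ} (hl : 0 ≤ l) (hlh : l ≤ h) :
    l * endHeight w f h ≤ h * endHeight w f l := by
  rw [endHeight, endHeight, mul_max_of_nonneg _ _ hl, mul_max_of_nonneg _ _ (hl.trans hlh)]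
  exact max_le_max (hf.mul_apply_le_mul_apply hl hlh) (hf.reflect.mul_apply_le_mul_apply hl hlh)

theorem sub_mul_endHeight_le (hf : IsConcaveProfile w f) {l h : ℝ} (hh : 0 ≤ h) (hhl : h ≤ l)
    (hl : l ≤ w) : (w - l) * endHeight w f h ≤ w * endHeight w f l := by
  have hle := max_le_max (hf.sub_mul_apply_le_sub_mul_apply hhl hl)
    (hf.reflect.sub_mul_apply_le_sub_mul_apply hhl hl)
  rw [← mul_max_of_nonneg _ _ (by linarith), ← mul_max_of_nonneg _ _ (by linarith)] at hle
  exact hle.trans (mul_le_mul_of_nonneg_right (by linarith) (hf.endHeight_nonneg l))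

theorem mul_apply_le_endHeight (hf : IsConcaveProfile w f) {l : ℝ} (hl : 0 ≤ l) (hlw : 3 * l ≤ w)
    (t : ℝ) : 2 * l * f t ≤ w * endHeight w f l := by
  wlog htw : 2 * t ≤ w generalizing f t
  · simpa [endHeight_reflect] using this hf.reflect (w - t) (by linarith)
  have hfl : f l ≤ endHeight w f l := le_max_left _ _
  have hH := hf.endHeight_nonneg l
  rcases le_or_gt t 0 with ht | ht
  · rw [hf.eq_zero_of_nonpos ht, mul_zero]
    exact mul_nonneg (by linarith) hH
  rcases le_total l t with hlt | htl
  · calc 2 * l * f t ≤ 2 * t * f l := by linarith [hf.mul_apply_le_mul_apply hl hlt]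
      _ ≤ w * endHeight w f l := mul_le_mul htw hfl (hf.nonneg l) (by linarith)
  · calc 2 * l * f t ≤ (w - l) * f t := mul_le_mul_of_nonneg_right (by linarith) (hf.nonneg t)
      _ ≤ (w - t) * f l := hf.sub_mul_apply_le_sub_mul_apply htl (by linarith)
      _ ≤ w * endHeight w f l := mul_le_mul (by linarith) hfl (hf.nonneg l) (by linarith)

theorem integrable (hf : IsConcaveProfile w f) : Integrable f := by
  have integrableOn_Ioo : IntegrableOn f (Ioo 0 w) := by
    refine IntegrableOn.of_bound (C := 3 / 2 * endHeight w f (w / 3)) (by simp)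
      ((hf.concaveOn.continuousOn isOpen_Ioo).aestronglyMeasurable measurableSet_Ioo) ?_
    refine ae_restrict_of_forall_mem measurableSet_Ioo fun t ht ↦ ?_
    have hw : 0 < w := ht.1.trans ht.2
    rw [Real.norm_of_nonneg (hf.nonneg t)]
    refine le_of_mul_le_mul_left ?_ hw
    linarith [hf.mul_apply_le_endHeight (l := w / 3) (by linarith) (by linarith) t]
  exact (integrableOn_iff_integrable_of_support_subset fun t ht ↦
    by_contra fun ht' ↦ ht (hf.eq_zero t ht')).1 integrableOn_Ioo

theorem second_difference_le_of_le (hf : IsConcaveProfile w f) {h t : ℝ} (hh : 0 < h)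
    (hw : 3 * h ≤ w) (ht : t ≤ h) :
    f (t + h) + f (t - h) - 2 * f t ≤ w / (w - h) * endHeight w f h := by
  have hhw : 0 < w - h := by linarith
  have hH := hf.endHeight_nonneg h
  have hfh : f h ≤ endHeight w f h := le_max_left _ _
  rw [hf.eq_zero_of_nonpos (by linarith : t - h ≤ 0), div_mul_eq_mul_div, le_div_iff₀ hhw]
  rcases le_or_gt t 0 with ht0 | ht0
  · rw [hf.eq_zero_of_nonpos ht0]
    rcases le_or_gt (t + h) 0 with hth | hth
    · rw [hf.eq_zero_of_nonpos hth]
      nlinarith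
    · have hmul : (w - (t + h)) * f h ≤ w * endHeight w f h :=
        mul_le_mul (by linarith) hfh (hf.nonneg h) (by linarith)
      linarith [hf.sub_mul_apply_le_sub_mul_apply (by linarith : t + h ≤ h) (by linarith)]
  · have hle : f (t + h) + 0 - 2 * f t ≤ endHeight w f h := by
      linarith [hf.apply_add_le ht0 hh, hf.nonneg t]
    nlinarith

theorem second_difference_le (hf : IsConcaveProfile w f) {h : ℝ} (hh : 0 < h) (hw : 3 * h ≤ w)
    (t : ℝ) : f (t + h) + f (t - h) - 2 * f t ≤
      (Icc (-h) h ∪ Icc (w - h) (w + h)).indicator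
        (fun _ ↦ w / (w - h) * endHeight w f h) t := by
  wlog htw : 2 * t ≤ w generalizing f t
  · have hreflect := this hf.reflect (w - t) (by linarith)
    have hmem : w - t ∈ Icc (-h) h ∪ Icc (w - h) (w + h) ↔
        t ∈ Icc (-h) h ∪ Icc (w - h) (w + h) := by
      simp only [mem_union, mem_Icc]
      grind
    simp only [endHeight_reflect, indicator_apply, hmem] at hreflect ⊢
    convert hreflect using 1
    ring_nf
  by_cases ht : t ∈ Icc (-h) h ∪ Icc (w - h) (w + h)
  · rw [indicator_of_mem ht]
    rcases ht with ht | ht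
    · exact hf.second_difference_le_of_le hh hw ht.2
    · linarith [ht.1]
  rw [indicator_of_notMem ht]
  rcases le_or_gt t (-h) with hth | hth
  · rw [hf.eq_zero_of_nonpos (by linarith : t + h ≤ 0), hf.eq_zero_of_nonpos (by linarith : t ≤ 0),
      hf.eq_zero_of_nonpos (by linarith : t - h ≤ 0)]
    norm_num
  have hht : h < t := not_le.1 fun hth' ↦ ht (Or.inl ⟨hth.le, hth'⟩)
  have midpoint := hf.concaveOn.2 (show t - h ∈ Ioo 0 w from ⟨by linarith, by linarith⟩)
    (show t + h ∈ Ioo 0 w from ⟨by linarith, by linarith⟩) (by norm_num : (0 : ℝ) ≤ 1 / 2)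
    (by norm_num : (0 : ℝ) ≤ 1 / 2) (by norm_num)
  simp only [smul_eq_mul] at midpoint
  rw [show 1 / 2 * (t - h) + 1 / 2 * (t + h) = t by ring] at midpoint
  linarith

theorem integral_abs_second_difference_le (hf : IsConcaveProfile w f) {h : ℝ} (hh : 0 < h)
    (hw : 3 * h ≤ w) :
    ∫ t, |f (t + h) + f (t - h) - 2 * f t| ≤ 8 * h * (w / (w - h) * endHeight w f h) := by
  set M := w / (w - h) * endHeight w f h
  have hM : 0 ≤ M := mul_nonneg (div_nonneg (by linarith) (by linarith)) (hf.endHeight_nonneg h)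
  have measurableSet_ends : MeasurableSet (Icc (-h) h ∪ Icc (w - h) (w + h)) :=
    measurableSet_Icc.union measurableSet_Icc
  have volume_ends : volume.real (Icc (-h) h ∪ Icc (w - h) (w + h)) = 4 * h := by
    rw [measureReal_union (disjoint_left.2 fun x hx hx' ↦ by linarith [hx.2, hx'.1])
      measurableSet_Icc (by simp) (by simp), Real.volume_real_Icc_of_le (by linarith),
      Real.volume_real_Icc_of_le (by linarith)]
    ring
  calc ∫ t, |f (t + h) + f (t - h) - 2 * f t|
      ≤ 2 * ∫ t, (Icc (-h) h ∪ Icc (w - h) (w + h)).indicator (fun _ ↦ M) t :=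
        integral_abs_le_two_mul_of_le (integrable_second_difference hf.integrable h)
          ((integrable_indicator_iff measurableSet_ends).2
            (integrableOn_const (measure_union_lt_top (by simp) (by simp)).ne))
          (integral_second_difference hf.integrable h) (hf.second_difference_le hh hw)
          (indicator_nonneg fun _ _ ↦ hM)
    _ = 8 * h * M := by
        rw [integral_indicator measurableSet_ends, setIntegral_const, volume_ends, smul_eq_mul]
        ring

theorem norm_fourier_le_of_step (hf : IsConcaveProfile w f) {h : ℝ} (hh : 0 < h)
    (hw : 3 * h ≤ w) : ‖𝓕 (fun t ↦ (f t : ℂ)) (1 / (2 * h))‖ ≤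
      2 * h * (w / (w - h) * endHeight w f h) := by
  have hnorm := norm_fourier_le_integral_norm
    (fun t ↦ ((f (t + h) + f (t - h) - 2 * f t : ℝ) : ℂ)) (1 / (2 * h))
  simp only [Complex.norm_real, Real.norm_eq_abs] at hnorm
  push_cast at hnorm
  rw [fourier_second_difference (f := fun t ↦ (f t : ℂ)) hf.integrable.ofReal hh.ne', norm_mul,
    norm_neg, Complex.norm_ofNat] at hnorm
  linarith [hf.integral_abs_second_difference_le hh hw]

theorem norm_fourier_le (hf : IsConcaveProfile w f) {l : ℝ} (hl : 0 ≤ l) (hlw : 3 * l ≤ w) (s : ℝ) :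
    2 * l * ‖𝓕 (fun t ↦ (f t : ℂ)) s‖ ≤ w ^ 2 * endHeight w f l := by
  have integral_le : ∫ t, 2 * l * f t ≤
      ∫ t, (Ioo 0 w).indicator (fun _ ↦ w * endHeight w f l) t := by
    refine integral_mono (hf.integrable.const_mul _)
      ((integrable_indicator_iff measurableSet_Ioo).2 (integrableOn_const (by simp))) fun t ↦ ?_
    by_cases ht : t ∈ Ioo 0 w
    · simpa only [indicator_of_mem ht] using hf.mul_apply_le_endHeight hl hlw t
    · simp only [indicator_of_notMem ht, hf.eq_zero t ht, mul_zero, le_rfl]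
  calc 2 * l * ‖𝓕 (fun t ↦ (f t : ℂ)) s‖ ≤ 2 * l * ∫ t, ‖(f t : ℂ)‖ :=
        mul_le_mul_of_nonneg_left (norm_fourier_le_integral_norm _ s) (by linarith)
    _ = ∫ t, 2 * l * f t := by
        simp only [Complex.norm_real, Real.norm_of_nonneg (hf.nonneg _), integral_const_mul]
    _ ≤ ∫ t, (Ioo 0 w).indicator (fun _ ↦ w * endHeight w f l) t := integral_le
    _ = w ^ 2 * endHeight w f l := by
        rw [integral_indicator measurableSet_Ioo, setIntegral_const,
          Real.volume_real_Ioo_of_le (by linarith), smul_eq_mul]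
        ring

theorem norm_fourier_le_sq_mul (hf : IsConcaveProfile w f) {h : ℝ} (hh : 1 ≤ h) (hw : 3 * h ≤ w) :
    ‖𝓕 (fun t ↦ (f t : ℂ)) (1 / (2 * h))‖ ≤ 3 * h ^ 2 * endHeight w f 1 := by
  have width_ratio : w / (w - h) ≤ 3 / 2 := by
    rw [div_le_iff₀ (by linarith)]
    linarith
  have height_le : endHeight w f h ≤ h * endHeight w f 1 := by
    simpa using hf.mul_endHeight_le zero_le_one hh
  have hH := hf.endHeight_nonneg h
  calc ‖𝓕 (fun t ↦ (f t : ℂ)) (1 / (2 * h))‖ ≤ 2 * h * (w / (w - h) * endHeight w f h) :=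
        hf.norm_fourier_le_of_step (by linarith) hw
    _ ≤ 2 * h * (3 / 2 * (h * endHeight w f 1)) := by gcongr
    _ = 3 * h ^ 2 * endHeight w f 1 := by ring

theorem norm_fourier_le_mul (hf : IsConcaveProfile w f) {h : ℝ} (hh : 0 < h) (hh1 : h ≤ 1)
    (hw : 10 ≤ w) : ‖𝓕 (fun t ↦ (f t : ℂ)) (1 / (2 * h))‖ ≤ 5 / 2 * h * endHeight w f 1 := by
  have width_ratio : w / (w - h) ≤ 10 / 9 := by
    rw [div_le_iff₀ (by linarith)]
    linarith
  have hH := hf.endHeight_nonneg h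
  have hH1 := hf.endHeight_nonneg 1
  have height_le : endHeight w f h ≤ 10 / 9 * endHeight w f 1 := by
    have scaled : 9 / 10 * w * endHeight w f h ≤ (w - 1) * endHeight w f h := by
      gcongr
      linarith
    exact le_of_mul_le_mul_left
      (by linarith [hf.sub_mul_endHeight_le hh.le hh1 (by linarith)]) (by linarith : 0 < w)
  calc ‖𝓕 (fun t ↦ (f t : ℂ)) (1 / (2 * h))‖ ≤ 2 * h * (w / (w - h) * endHeight w f h) :=
        hf.norm_fourier_le_of_step hh (by linarith)
    _ ≤ 2 * h * (10 / 9 * (10 / 9 * endHeight w f 1)) := by gcongr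
    _ = 200 / 81 * h * endHeight w f 1 := by ring
    _ ≤ 5 / 2 * h * endHeight w f 1 := by
        gcongr ?_ * h * _
        norm_num

theorem sq_mul_norm_fourier_le (hf : IsConcaveProfile w f) (hw : 10 ≤ w) {δ : ℝ} (hδ : 0 < δ)
    (hδ1 : δ ≤ 1) : δ ^ 2 * ‖𝓕 (fun t ↦ (f t : ℂ)) δ‖ ≤ 5 / 4 * endHeight w f 1 := by
  have hH := hf.endHeight_nonneg 1
  obtain ⟨h, hh, rfl⟩ : ∃ h, 0 < h ∧ 1 / (2 * h) = δ :=
    ⟨1 / (2 * δ), by positivity, by field_simp⟩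
  set δ := 1 / (2 * h)
  have hδh : δ * h = 1 / 2 := by simp only [δ]; field_simp
  rcases lt_or_ge w (3 * h) with hwh | hwh
  · have hδw : δ * w ≤ 3 / 2 := by nlinarith
    calc δ ^ 2 * ‖𝓕 (fun t ↦ (f t : ℂ)) δ‖ ≤ δ ^ 2 * (w ^ 2 * endHeight w f 1 / 2) := by
          gcongr
          linarith [hf.norm_fourier_le zero_le_one (by linarith) δ]
      _ = (δ * w) ^ 2 * (endHeight w f 1 / 2) := by ring
      _ ≤ (3 / 2) ^ 2 * (endHeight w f 1 / 2) := by gcongr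
      _ ≤ 5 / 4 * endHeight w f 1 := by linarith
  rcases le_total 1 h with hh1 | hh1
  · calc δ ^ 2 * ‖𝓕 (fun t ↦ (f t : ℂ)) δ‖ ≤ δ ^ 2 * (3 * h ^ 2 * endHeight w f 1) := by
          gcongr
          exact hf.norm_fourier_le_sq_mul hh1 hwh
      _ = 3 * (δ * h) ^ 2 * endHeight w f 1 := by ring
      _ ≤ 5 / 4 * endHeight w f 1 := by rw [hδh]; linarith
  · calc δ ^ 2 * ‖𝓕 (fun t ↦ (f t : ℂ)) δ‖ ≤ δ ^ 2 * (5 / 2 * h * endHeight w f 1) := by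
          gcongr
          exact hf.norm_fourier_le_mul hh hh1 hw
      _ = δ * (5 / 2 * (δ * h) * endHeight w f 1) := by ring
      _ ≤ 1 * (5 / 2 * (δ * h) * endHeight w f 1) := by gcongr
      _ = 5 / 4 * endHeight w f 1 := by rw [hδh]; ring

end IsConcaveProfile

theorem integral_eval_mul_cos (p : Polynomial ℝ) {x : ℝ} (hx : x ≠ 0) :
    ∫ s in (0 : ℝ)..1, p.eval s * Real.cos (s * x) =
      p.eval 1 * Real.sin x / x +
        (p.derivative.eval 1 * Real.cos x - p.derivative.eval 0) / x ^ 2 -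
        (∫ s in (0 : ℝ)..1, p.derivative.derivative.eval s * Real.cos (s * x)) / x ^ 2 := by
  have primitive (s : ℝ) : HasDerivAt
      (fun s ↦ p.eval s * Real.sin (s * x) / x + p.derivative.eval s * Real.cos (s * x) / x ^ 2)
      (p.eval s * Real.cos (s * x) +
        p.derivative.derivative.eval s * Real.cos (s * x) / x ^ 2) s := by
    have hmul : HasDerivAt (fun s ↦ s * x) x s := by simpa using (hasDerivAt_id s).mul_const x
    refine ((((p.hasDerivAt s).mul hmul.sin).div_const x).add
      (((p.derivative.hasDerivAt s).mul hmul.cos).div_const (x ^ 2))).congr_deriv ?_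
    field_simp
    ring
  have ftc := intervalIntegral.integral_eq_sub_of_hasDerivAt (a := 0) (b := 1)
    (fun s _ ↦ primitive s) (Continuous.intervalIntegrable (by fun_prop) _ _)
  rw [intervalIntegral.integral_add (Continuous.intervalIntegrable (by fun_prop) _ _)
    (Continuous.intervalIntegrable (by fun_prop) _ _), intervalIntegral.integral_div] at ftc
  rw [eq_sub_iff_add_eq, ftc]
  simp only [one_mul, zero_mul, Real.sin_zero, Real.cos_zero]
  ring

theorem integral_sq_mul_one_sub_cube_mul_cos_le {x : ℝ} (hx : 12 ≤ x) :
    ∫ s in (0 : ℝ)..1, s ^ 2 * (1 - s) ^ 3 * Real.cos (s * x) ≤ -(6 / x ^ 4) := by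
  have hx0 : x ≠ 0 := by positivity
  have closed_form : ∫ s in (0 : ℝ)..1, s ^ 2 * (1 - s) ^ 3 * Real.cos (s * x) =
      ((6 * Real.cos x - 18) * x ^ 2 - 48 * Real.sin x * x + 120 * (1 - Real.cos x)) / x ^ 6 := by
    have eval_eq (s : ℝ) : s ^ 2 * (1 - s) ^ 3 =
        (.X ^ 2 - 3 * .X ^ 3 + 3 * .X ^ 4 - .X ^ 5 : Polynomial ℝ).eval s := by
      simp only [Polynomial.eval_sub, Polynomial.eval_add, Polynomial.eval_mul,
        Polynomial.eval_pow, Polynomial.eval_X, Polynomial.eval_ofNat]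
      ring
    simp only [eval_eq]
    rw [integral_eval_mul_cos _ hx0, integral_eval_mul_cos _ hx0, integral_eval_mul_cos _ hx0]
    simp
    field_simp
    ring
  have numerator_le : (6 * Real.cos x - 18) * x ^ 2 - 48 * Real.sin x * x +
      120 * (1 - Real.cos x) ≤ -6 * x ^ 2 := by
    nlinarith [Real.neg_one_le_sin x, Real.cos_le_one x, Real.neg_one_le_cos x]
  calc _ ≤ -6 * x ^ 2 / x ^ 6 := by rw [closed_form]; gcongr
    _ = -(6 / x ^ 4) := by field_simp

theorem sq_intervalIntegral_le {g : ℝ → ℝ} (hg : Continuous g) :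
    (∫ s in (0 : ℝ)..1, g s) ^ 2 ≤ ∫ s in (0 : ℝ)..1, g s ^ 2 := by
  have : IsProbabilityMeasure (volume.restrict (Ioc (0 : ℝ) 1)) := ⟨by simp⟩
  simp only [intervalIntegral.integral_of_le zero_le_one]
  exact even_two.convexOn_pow.map_integral_le (by fun_prop) isClosed_univ (by simp)
    (hg.integrableOn_Ioc) ((hg.pow 2).integrableOn_Ioc)

/-- The weight `-s² (1 - s)³ exp (-12is)` on `(0, 1]`. Its size is at most `s²`, while the real part
of its Fourier transform is positive on the half-line `[0, ∞)`, which carries every concave profile;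
the phase keeps the frequency `2πt + 12` away from the origin, where the sign would fail. -/
def testWeight : ℝ → ℂ :=
  (Ioc 0 1).indicator fun s ↦
    (-(s ^ 2 * (1 - s) ^ 3) : ℝ) * Complex.exp ((-(12 * s) : ℝ) * Complex.I)

theorem norm_testWeight_le (s : ℝ) : ‖testWeight s‖ ≤ (Ioc 0 1).indicator (· ^ 2) s := by
  rw [testWeight, norm_indicator_eq_indicator_norm]
  refine indicator_rel_indicator le_rfl fun hs ↦ ?_
  have hs1 : 0 ≤ 1 - s := sub_nonneg.2 hs.2
  rw [norm_mul, Complex.norm_exp_ofReal_mul_I, mul_one, Complex.norm_real, norm_neg,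
    Real.norm_of_nonneg (by positivity)]
  exact mul_le_of_le_one_right (sq_nonneg s) (pow_le_one₀ hs1 (by linarith [hs.1]))

theorem integrable_testWeight : Integrable testWeight :=
  (integrable_indicator_iff measurableSet_Ioc).2 <| Continuous.integrableOn_Ioc (by fun_prop)

theorem re_fourier_testWeight (t : ℝ) : (𝓕 testWeight t).re =
    -∫ s in (0 : ℝ)..1, s ^ 2 * (1 - s) ^ 3 * Real.cos (s * (2 * Real.pi * t + 12)) := by
  set g : ℝ → ℂ := fun s ↦
    (-(s ^ 2 * (1 - s) ^ 3) : ℝ) * Complex.exp ((-(s * (2 * Real.pi * t + 12)) : ℝ) * Complex.I)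
  have fourier_eq : 𝓕 testWeight t = ∫ s in (0 : ℝ)..1, g s := by
    rw [Real.fourier_real_eq_integral_exp_smul, intervalIntegral.integral_of_le zero_le_one,
      ← integral_indicator measurableSet_Ioc]
    refine integral_congr_ae (ae_of_all _ fun s ↦ ?_)
    by_cases hs : s ∈ Ioc 0 1
    · simp only [testWeight, indicator_of_mem hs, smul_eq_mul, g]
      rw [mul_left_comm, ← Complex.exp_add]
      congr 2
      push_cast
      ring
    · simp only [testWeight, indicator_of_notMem hs, smul_zero]
  have re_g (s : ℝ) : (g s).re =
      -(s ^ 2 * (1 - s) ^ 3 * Real.cos (s * (2 * Real.pi * t + 12))) := by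
    rw [Complex.re_ofReal_mul, Complex.exp_ofReal_mul_I_re, Real.cos_neg, neg_mul]
  have hg : IntegrableOn g (Ioc 0 1) := Continuous.integrableOn_Ioc (by fun_prop)
  rw [fourier_eq, ← intervalIntegral.integral_neg]
  simp only [← re_g, intervalIntegral.integral_of_le zero_le_one]
  exact (integral_re hg).symm

theorem div_pow_le_re_fourier_testWeight {t : ℝ} (ht : 0 ≤ t) :
    6 / (2 * Real.pi * t + 12) ^ 4 ≤ (𝓕 testWeight t).re := by
  rw [re_fourier_testWeight]
  have hpi : 0 ≤ 2 * Real.pi * t := by positivity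
  linarith [integral_sq_mul_one_sub_cube_mul_cos_le (x := 2 * Real.pi * t + 12) (by linarith)]

theorem integral_mul_re_fourier_testWeight_le {f : ℝ → ℝ} (hf : Integrable f) :
    ∫ t, f t * (𝓕 testWeight t).re ≤
      ∫ s in (0 : ℝ)..1, s ^ 2 * ‖𝓕 (fun t ↦ (f t : ℂ)) s‖ := by
  have hcont : Continuous fun s ↦ ‖𝓕 (fun t ↦ (f t : ℂ)) s‖ := (continuous_fourier hf.ofReal).norm
  refine (integral_mul_re_fourier_le hf integrable_testWeight).trans ?_
  rw [intervalIntegral.integral_of_le zero_le_one, ← integral_indicator measurableSet_Ioc]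
  refine integral_mono (integrable_testWeight.norm.bdd_mul (c := ∫ t, ‖f t‖)
      hcont.aestronglyMeasurable (ae_of_all _ fun s ↦ ?_))
    ((integrable_indicator_iff measurableSet_Ioc).2 (Continuous.integrableOn_Ioc (by fun_prop)))
    fun s ↦ ?_
  · simpa using norm_fourier_le_integral_norm (fun t ↦ (f t : ℂ)) s
  · rw [indicator_mul_left (Ioc 0 1) (· ^ 2) fun s ↦ ‖𝓕 (fun t ↦ (f t : ℂ)) s‖, mul_comm]
    exact mul_le_mul_of_nonneg_right (norm_testWeight_le s) (norm_nonneg _)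

namespace IsConcaveProfile

variable {w : ℝ} {f : ℝ → ℝ}

theorem half_apply_one_le (hf : IsConcaveProfile w f) (hw : 3 ≤ w) {t : ℝ}
    (ht : t ∈ Icc 1 2) : f 1 / 2 ≤ f t := by
  have hchord := hf.sub_mul_apply_le_sub_mul_apply ht.1 (by linarith [ht.2])
  refine le_of_mul_le_mul_left ?_ (by linarith : 0 < w - 1)
  calc (w - 1) * (f 1 / 2) = (w - 1) / 2 * f 1 := by ring
    _ ≤ (w - t) * f 1 := mul_le_mul_of_nonneg_right (by linarith [ht.2]) (hf.nonneg 1)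
    _ ≤ (w - 1) * f t := hchord

theorem mul_apply_one_le_integral_mul_re_fourier_testWeight (hf : IsConcaveProfile w f)
    (hw : 3 ≤ w) : 3 / 390625 * f 1 ≤ ∫ t, f t * (𝓕 testWeight t).re := by
  have integrable_mul : Integrable fun t ↦ f t * (𝓕 testWeight t).re :=
    hf.integrable.mul_bdd
      (Complex.continuous_re.comp (continuous_fourier integrable_testWeight)).aestronglyMeasurable
      (ae_of_all _ fun t ↦ (Complex.abs_re_le_norm _).trans (norm_fourier_le_integral_norm _ t))
  have indicator_le (t : ℝ) :
      (Icc 1 2).indicator (fun _ ↦ f 1 / 2 * (6 / 390625)) t ≤ f t * (𝓕 testWeight t).re := by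
    refine indicator_apply_le' (fun ht ↦ ?_) fun _ ↦ ?_
    · have ht0 : 0 ≤ t := zero_le_one.trans ht.1
      have frequency_le : 2 * Real.pi * t + 12 ≤ 25 := by
        nlinarith [ht.2, Real.pi_lt_d2, Real.pi_pos]
      have weight_ge : 6 / 390625 ≤ (𝓕 testWeight t).re :=
        calc (6 : ℝ) / 390625 = 6 / 25 ^ 4 := by norm_num
          _ ≤ 6 / (2 * Real.pi * t + 12) ^ 4 := by gcongr
          _ ≤ (𝓕 testWeight t).re := div_pow_le_re_fourier_testWeight ht0
      exact mul_le_mul (hf.half_apply_one_le hw ht) weight_ge (by norm_num) (hf.nonneg t)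
    · rcases le_total t 0 with ht | ht
      · rw [hf.eq_zero_of_nonpos ht, zero_mul]
      · exact mul_nonneg (hf.nonneg t)
          (le_trans (by positivity) (div_pow_le_re_fourier_testWeight ht))
  calc 3 / 390625 * f 1 = ∫ t, (Icc 1 2).indicator (fun _ ↦ f 1 / 2 * (6 / 390625)) t := by
        rw [integral_indicator measurableSet_Icc, setIntegral_const,
          Real.volume_real_Icc_of_le one_le_two, smul_eq_mul]
        ring
    _ ≤ ∫ t, f t * (𝓕 testWeight t).re :=
        integral_mono ((integrable_indicator_iff measurableSet_Icc).2
          (integrableOn_const (by simp))) integrable_mul indicator_le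

theorem mul_apply_one_le_integral_sq_mul_norm_fourier (hf : IsConcaveProfile w f) (hw : 3 ≤ w) :
    3 / 390625 * f 1 ≤ ∫ s in (0 : ℝ)..1, s ^ 2 * ‖𝓕 (fun t ↦ (f t : ℂ)) s‖ :=
  (hf.mul_apply_one_le_integral_mul_re_fourier_testWeight hw).trans
    (integral_mul_re_fourier_testWeight_le hf.integrable)

theorem mul_endHeight_one_le_integral_sq_mul_norm_fourier (hf : IsConcaveProfile w f)
    (hw : 3 ≤ w) :
    3 / 390625 * endHeight w f 1 ≤ ∫ s in (0 : ℝ)..1, s ^ 2 * ‖𝓕 (fun t ↦ (f t : ℂ)) s‖ := by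
  have hreflect := hf.reflect.mul_apply_one_le_integral_sq_mul_norm_fourier hw
  simp only [norm_fourier_comp_sub_left] at hreflect
  rw [endHeight, mul_max_of_nonneg _ _ (by norm_num)]
  exact max_le (hf.mul_apply_one_le_integral_sq_mul_norm_fourier hw) hreflect

theorem continuous_sq_mul_norm_fourier (hf : IsConcaveProfile w f) :
    Continuous fun s : ℝ ↦ s ^ 2 * ‖𝓕 (fun t ↦ (f t : ℂ)) s‖ :=
  (continuous_pow 2).mul (continuous_fourier hf.integrable.ofReal).norm

theorem sq_endHeight_one_le_integral (hf : IsConcaveProfile w f) (hw : 3 ≤ w) :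
    (3 / 390625) ^ 2 * endHeight w f 1 ^ 2 ≤
      ∫ s in (0 : ℝ)..1, (s ^ 2 * ‖𝓕 (fun t ↦ (f t : ℂ)) s‖) ^ 2 := by
  have hH := hf.endHeight_nonneg 1
  calc (3 / 390625) ^ 2 * endHeight w f 1 ^ 2 = (3 / 390625 * endHeight w f 1) ^ 2 := by ring
    _ ≤ (∫ s in (0 : ℝ)..1, s ^ 2 * ‖𝓕 (fun t ↦ (f t : ℂ)) s‖) ^ 2 := by
        gcongr
        exact hf.mul_endHeight_one_le_integral_sq_mul_norm_fourier hw
    _ ≤ ∫ s in (0 : ℝ)..1, (s ^ 2 * ‖𝓕 (fun t ↦ (f t : ℂ)) s‖) ^ 2 :=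
        sq_intervalIntegral_le hf.continuous_sq_mul_norm_fourier

theorem integral_le_sq_endHeight_one (hf : IsConcaveProfile w f) (hw : 10 ≤ w) :
    ∫ s in (0 : ℝ)..1, (s ^ 2 * ‖𝓕 (fun t ↦ (f t : ℂ)) s‖) ^ 2 ≤ 2 * endHeight w f 1 ^ 2 := by
  have sq_le (s : ℝ) (hs : s ∈ Ioo 0 1) :
      (s ^ 2 * ‖𝓕 (fun t ↦ (f t : ℂ)) s‖) ^ 2 ≤ 2 * endHeight w f 1 ^ 2 :=
    calc (s ^ 2 * ‖𝓕 (fun t ↦ (f t : ℂ)) s‖) ^ 2 ≤ (5 / 4 * endHeight w f 1) ^ 2 := by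
          gcongr ?_ ^ 2
          exact hf.sq_mul_norm_fourier_le hw hs.1 hs.2.le
      _ ≤ 2 * endHeight w f 1 ^ 2 := by linarith [sq_nonneg (endHeight w f 1)]
  refine (intervalIntegral.integral_mono_on_of_le_Ioo zero_le_one
    ((hf.continuous_sq_mul_norm_fourier.pow 2).intervalIntegrable 0 1)
    (intervalIntegrable_const (μ := volume)) sq_le).trans_eq ?_
  rw [intervalIntegral.integral_const, sub_zero, one_smul]

theorem integral_sq_mul_norm_fourier_bounds (hf : IsConcaveProfile w f) {ρ : ℝ} (hρ : 0 < ρ)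
    (hw : 10 ≤ w * ρ) :
    (3 / 390625) ^ 2 * (ρ ^ 2)⁻¹ * endHeight w f ρ⁻¹ ^ 2 ≤
        ∫ s in (0 : ℝ)..1, (s ^ 2 * ‖𝓕 (fun t ↦ (f t : ℂ)) (ρ * s)‖) ^ 2 ∧
      ∫ s in (0 : ℝ)..1, (s ^ 2 * ‖𝓕 (fun t ↦ (f t : ℂ)) (ρ * s)‖) ^ 2 ≤
        2 * (ρ ^ 2)⁻¹ * endHeight w f ρ⁻¹ ^ 2 := by
  set g : ℝ → ℝ := fun t ↦ f (ρ⁻¹ * t)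
  have hg : IsConcaveProfile (w * ρ) g := hf.comp_inv_mul hρ
  have endHeight_g : endHeight (w * ρ) g 1 = endHeight w f ρ⁻¹ := by
    simp only [endHeight, g, mul_one, mul_sub, mul_comm w, inv_mul_cancel_left₀ hρ.ne']
  have fourier_g (s : ℝ) : ‖𝓕 (fun t ↦ (g t : ℂ)) s‖ = ρ * ‖𝓕 (fun t ↦ (f t : ℂ)) (ρ * s)‖ := by
    have h := fourier_comp_smul (fun t ↦ (f t : ℂ)) (inv_ne_zero hρ.ne') s
    simp only [smul_eq_mul, Module.finrank_self, pow_one, inv_inv, abs_of_pos hρ] at h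
    rw [h, norm_smul, Real.norm_of_nonneg hρ.le]
  have integral_g : ∫ s in (0 : ℝ)..1, (s ^ 2 * ‖𝓕 (fun t ↦ (g t : ℂ)) s‖) ^ 2 =
      ρ ^ 2 * ∫ s in (0 : ℝ)..1, (s ^ 2 * ‖𝓕 (fun t ↦ (f t : ℂ)) (ρ * s)‖) ^ 2 := by
    rw [← intervalIntegral.integral_const_mul]
    simp only [fourier_g, mul_left_comm _ ρ, mul_pow]
  have lower := hg.sq_endHeight_one_le_integral (by linarith)
  have upper := hg.integral_le_sq_endHeight_one hw
  rw [integral_g, endHeight_g] at lower upper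
  rw [mul_right_comm, mul_right_comm 2, ← div_eq_mul_inv, ← div_eq_mul_inv,
    div_le_iff₀' (by positivity), le_div_iff₀' (by positivity)]
  exact ⟨lower, upper⟩

end IsConcaveProfile

theorem diam_add {s t : Set ℝ} (hs : s.Nonempty) (ht : t.Nonempty) (hsb : Bornology.IsBounded s)
    (htb : Bornology.IsBounded t) : Metric.diam (s + t) = Metric.diam s + Metric.diam t := by
  rw [Real.diam_eq (hsb.add htb), Real.diam_eq hsb, Real.diam_eq htb,
    csSup_add hs hsb.bddAbove ht htb.bddAbove, csInf_add hs hsb.bddBelow ht htb.bddBelow]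
  ring

theorem volume_real_eq_diam {s : Set ℝ} (hs : Convex ℝ s) (hb : Bornology.IsBounded s) :
    volume.real s = Metric.diam s := by
  rcases s.eq_empty_or_nonempty with rfl | hne
  · simp
  have hle : sInf s ≤ sSup s := Real.sInf_le_sSup s hb.bddBelow hb.bddAbove
  rw [Real.diam_eq hb]
  apply le_antisymm
  · rw [← Real.volume_real_Icc_of_le hle]
    exact measureReal_mono (subset_Icc_csInf_csSup hb.bddBelow hb.bddAbove) (by simp)
  · rw [← Real.volume_real_Ioo_of_le hle]
    have hconn : IsConnected s := ⟨hne, hs.isPreconnected⟩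
    exact measureReal_mono (hconn.Ioo_csInf_csSup_subset hb.bddBelow hb.bddAbove)
      hb.measure_lt_top.ne

namespace PlanarBody

/-- The angle `θ + π / 2`, so that `u (perp θ)` spans the lines on which the chords of direction
`u θ` lie. -/
def perp (θ : Real.Angle) : Real.Angle := θ + ((Real.pi / 2 : ℝ) : Real.Angle)

theorem norm_u (θ : Real.Angle) : ‖u θ‖ = 1 := by
  rw [EuclideanSpace.norm_eq, Fin.sum_univ_two, Real.sqrt_eq_one]
  simp [u]

theorem inner_u_perp (θ : Real.Angle) : ⟪u θ, u (perp θ)⟫ = 0 := by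
  simp [u, perp, PiLp.inner_apply, Fin.sum_univ_two, Real.Angle.cos_add, Real.Angle.sin_add,
    mul_comm]

theorem u_add_pi (θ : Real.Angle) : u (θ + (Real.pi : Real.Angle)) = -u θ := by
  ext i
  fin_cases i <;> simp [u]

theorem orthonormal_u_perp (θ : Real.Angle) : Orthonormal ℝ ![u θ, u (perp θ)] := by
  simp [orthonormal_vecCons_iff, norm_u, inner_u_perp]

/-- The orthonormal basis `u θ, u (θ + π / 2)` of the plane. -/
def frame (θ : Real.Angle) : OrthonormalBasis (Fin 2) ℝ Plane :=
  OrthonormalBasis.mk (orthonormal_u_perp θ)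
    ((orthonormal_u_perp θ).linearIndependent.span_eq_top_of_card_eq_finrank' (by simp)).ge

theorem norm_sq_eq (θ : Real.Angle) (x : Plane) :
    ‖x‖ ^ 2 = ⟪x, u θ⟫ ^ 2 + ⟪x, u (perp θ)⟫ ^ 2 := by
  simpa [frame, Fin.sum_univ_two] using ((frame θ).sum_sq_norm_inner_left x).symm

/-- The coordinates of a point in the basis `u θ, u (θ + π / 2)`, as a pair so that Fubini's
theorem applies. -/
def coords (θ : Real.Angle) : Plane ≃ᵐ ℝ × ℝ :=
  ((frame θ).measurableEquiv.trans (MeasurableEquiv.toLp 2 (Fin 2 → ℝ)).symm).trans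
    MeasurableEquiv.finTwoArrow

theorem measurePreserving_coords (θ : Real.Angle) : MeasurePreserving (coords θ) :=
  ((frame θ).measurePreserving_measurableEquiv.trans
    (EuclideanSpace.volume_preserving_symm_measurableEquiv_toLp (Fin 2))).trans
      (volume_preserving_finTwoArrow ℝ)

theorem coords_symm_apply (θ : Real.Angle) (p : ℝ × ℝ) :
    (coords θ).symm p = p.1 • u θ + p.2 • u (perp θ) := by
  change (frame θ).repr.symm (WithLp.toLp 2 ![p.1, p.2]) = _
  simp [← OrthonormalBasis.sum_repr_symm, frame, Fin.sum_univ_two]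

theorem inner_coords_symm (θ : Real.Angle) (p : ℝ × ℝ) : ⟪(coords θ).symm p, u θ⟫ = p.1 := by
  simp [coords_symm_apply, inner_add_left, inner_smul_left, norm_u, real_inner_comm,
    inner_u_perp]

theorem fourier_smul_u {f : Plane → ℂ} (hf : Integrable f) (θ : Real.Angle) (s : ℝ) :
    𝓕 f (s • u θ) = 𝓕 (fun t ↦ ∫ r, f ((coords θ).symm (t, r))) s := by
  have hcoords := (measurePreserving_coords θ).symm
  have integrable_coords : Integrable fun p : ℝ × ℝ ↦
      Real.fourierChar (-⟪p.1, s⟫) • f ((coords θ).symm p) :=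
    (VectorFourier.fourierIntegral_convergent_iff Real.continuous_fourierChar
      (L := (innerₗ ℝ).comp (LinearMap.fst ℝ ℝ ℝ)) (by fun_prop) s).2
      ((hcoords.integrable_comp_emb (coords θ).symm.measurableEmbedding).2 hf)
  have inner_coords (p : ℝ × ℝ) : ⟪(coords θ).symm p, s • u θ⟫ = ⟪p.1, s⟫ := by
    rw [inner_smul_right, inner_coords_symm, Real.inner_apply, mul_comm]
  rw [Real.fourier_eq, Real.fourier_eq, ← hcoords.integral_comp']
  simp only [inner_coords]
  rw [Measure.volume_eq_prod, integral_prod _ integrable_coords]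
  simp only [Circle.smul_def, integral_smul]

/-- The slice of `C` by the line `x · u θ = t`, in the coordinate along `u (θ + π / 2)`. -/
def slice (C : Set Plane) (θ : Real.Angle) (t : ℝ) : Set ℝ :=
  {r | t • u θ + r • u (perp θ) ∈ C}

theorem isometry_line (θ : Real.Angle) (t : ℝ) :
    Isometry fun r : ℝ ↦ t • u θ + r • u (perp θ) :=
  Isometry.of_dist_eq fun x y ↦ by
    rw [dist_add_left, dist_eq_norm, ← sub_smul, norm_smul, norm_u, mul_one, dist_eq_norm]

theorem setOf_inner_eq_image_slice (C : Set Plane) (θ : Real.Angle) (t : ℝ) :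
    {x | x ∈ C ∧ ⟪x, u θ⟫ = t} = (fun r : ℝ ↦ t • u θ + r • u (perp θ)) '' slice C θ t := by
  ext x
  constructor
  · rintro ⟨hx, rfl⟩
    obtain ⟨p, rfl⟩ := (coords θ).symm.surjective x
    rw [inner_coords_symm]
    rw [coords_symm_apply] at hx ⊢
    exact ⟨p.2, hx, rfl⟩
  · rintro ⟨r, hr, rfl⟩
    exact ⟨hr, by simpa only [coords_symm_apply] using inner_coords_symm θ (t, r)⟩

theorem smul_slice_add_smul_slice_subset {C : Set Plane} (hC : Convex ℝ C) (θ : Real.Angle)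
    (t t' : ℝ) {a b : ℝ} (ha : 0 ≤ a) (hb : 0 ≤ b) (hab : a + b = 1) :
    a • slice C θ t + b • slice C θ t' ⊆ slice C θ (a * t + b * t') := by
  rintro _ ⟨_, ⟨x, hx, rfl⟩, _, ⟨y, hy, rfl⟩, rfl⟩
  have combination : a • (t • u θ + x • u (perp θ)) + b • (t' • u θ + y • u (perp θ)) =
      (a * t + b * t') • u θ + (a • x + b • y) • u (perp θ) := by
    simp only [smul_eq_mul]
    module
  change (a * t + b * t') • u θ + (a • x + b • y) • u (perp θ) ∈ C
  rw [← combination]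
  exact hC hx hy ha hb hab

theorem convex_slice {C : Set Plane} (hC : Convex ℝ C) (θ : Real.Angle) (t : ℝ) :
    Convex ℝ (slice C θ t) :=
  convex_iff_pointwise_add_subset.2 fun a b ha hb hab ↦ by
    simpa only [← add_mul, hab, one_mul] using smul_slice_add_smul_slice_subset hC θ t t ha hb hab

theorem isBounded_slice {C : Set Plane} (hC : Bornology.IsBounded C) (θ : Real.Angle) (t : ℝ) :
    Bornology.IsBounded (slice C θ t) :=
  (isometry_line θ t).antilipschitz.isBounded_preimage hC

theorem diam_slice_concave {C : Set Plane} (hC : Convex ℝ C) (hbdd : Bornology.IsBounded C)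
    (θ : Real.Angle) {t t' a b : ℝ} (ht : (slice C θ t).Nonempty) (ht' : (slice C θ t').Nonempty)
    (ha : 0 ≤ a) (hb : 0 ≤ b) (hab : a + b = 1) :
    a * Metric.diam (slice C θ t) + b * Metric.diam (slice C θ t') ≤
      Metric.diam (slice C θ (a * t + b * t')) :=
  calc a * Metric.diam (slice C θ t) + b * Metric.diam (slice C θ t')
      = Metric.diam (a • slice C θ t + b • slice C θ t') := by
        rw [diam_add ht.smul_set ht'.smul_set ((isBounded_slice hbdd θ t).smul₀ a)
          ((isBounded_slice hbdd θ t').smul₀ b), diam_smul₀, diam_smul₀, Real.norm_of_nonneg ha,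
          Real.norm_of_nonneg hb]
    _ ≤ Metric.diam (slice C θ (a * t + b * t')) :=
        Metric.diam_mono (smul_slice_add_smul_slice_subset hC θ t t' ha hb hab)
          (isBounded_slice hbdd θ _)

theorem indicatorFourier_smul_u {C : Set Plane} (hC : Convex ℝ C) (hbdd : Bornology.IsBounded C)
    (θ : Real.Angle) (s : ℝ) :
    indicatorFourier C (s • u θ) = 𝓕 (fun t ↦ (Metric.diam (slice C θ t) : ℂ)) s := by
  have integrable_indicator_one : Integrable (C.indicator fun _ ↦ (1 : ℂ)) :=
    (integrableOn_const hbdd.measure_lt_top.ne).integrable_indicator₀ (hC.nullMeasurableSet volume)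
  rw [indicatorFourier, fourier_smul_u integrable_indicator_one]
  refine Real.fourier_congr_ae (ae_of_all _ fun t ↦ ?_) s
  have indicator_slice : (fun r ↦ C.indicator (fun _ ↦ (1 : ℂ)) ((coords θ).symm (t, r))) =
      (slice C θ t).indicator fun _ ↦ 1 := by
    simp only [coords_symm_apply]
    rfl
  rw [indicator_slice, integral_indicator₀ ((convex_slice hC θ t).nullMeasurableSet volume),
    setIntegral_const, volume_real_eq_diam (convex_slice hC θ t) (isBounded_slice hbdd θ t),
    Complex.real_smul, mul_one]

theorem indicatorFourier_smul (C : Set Plane) {δ : ℝ} (hδ : δ ≠ 0) (ξ : Plane) :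
    indicatorFourier (δ • C) ξ = δ ^ 2 • indicatorFourier C (δ • ξ) := by
  have indicator_smul : (δ • C).indicator (fun _ ↦ (1 : ℂ)) =
      fun x ↦ C.indicator (fun _ ↦ 1) (δ⁻¹ • x) := by
    rw [← preimage_smul_inv₀ hδ]
    rfl
  rw [indicatorFourier, indicator_smul, fourier_comp_smul _ (inv_ne_zero hδ),
    finrank_euclideanSpace_fin, inv_pow, inv_inv, inv_inv, abs_sq, indicatorFourier]

/-- The least value `inf_{y ∈ C} y · u θ`, at which the distances of chords start. -/
def infInner (C : Set Plane) (θ : Real.Angle) : ℝ := ⨅ y : C, ⟪(y : Plane), u θ⟫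

/-- The width of `C` in direction `u θ`; note that `-infInner C (θ + π)` is the largest value of
`y · u θ` on `C`. -/
def width (C : Set Plane) (θ : Real.Angle) : ℝ :=
  -infInner C (θ + (Real.pi : Real.Angle)) - infInner C θ

theorem chordLength_eq_diam_slice (C : Set Plane) (θ : Real.Angle) (l : ℝ) :
    chordLength C θ l = Metric.diam (slice C θ (infInner C θ + l)) := by
  rw [← (isometry_line θ _).diam_image, ← setOf_inner_eq_image_slice]
  rfl

theorem chordLength_add_pi (C : Set Plane) (θ : Real.Angle) (l : ℝ) :
    chordLength C (θ + (Real.pi : Real.Angle)) l = chordLength C θ (width C θ - l) := by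
  change Metric.diam {x | x ∈ C ∧ ⟪x, u (θ + Real.pi)⟫ = infInner C (θ + Real.pi) + l} =
    Metric.diam {x | x ∈ C ∧ ⟪x, u θ⟫ = infInner C θ + (width C θ - l)}
  simp only [width, u_add_pi, inner_neg_right]
  grind

theorem infInner_le {C : Set Plane} (hC : Bornology.IsBounded C) (θ : Real.Angle) {x : Plane}
    (hx : x ∈ C) : infInner C θ ≤ ⟪x, u θ⟫ := by
  obtain ⟨R, hR⟩ := hC.exists_norm_le
  refine ciInf_le (f := fun y : C ↦ ⟪(y : Plane), u θ⟫) ⟨-R, ?_⟩ ⟨x, hx⟩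
  rintro _ ⟨y, rfl⟩
  have h := neg_le_of_abs_le (abs_real_inner_le_norm (y : Plane) (u θ))
  rw [norm_u, mul_one] at h
  exact (neg_le_neg (hR y y.2)).trans h

theorem inner_le_infInner_add_width {C : Set Plane} (hC : Bornology.IsBounded C) (θ : Real.Angle)
    {x : Plane} (hx : x ∈ C) : ⟪x, u θ⟫ ≤ infInner C θ + width C θ := by
  have h := infInner_le hC (θ + Real.pi) hx
  rw [u_add_pi, inner_neg_right] at h
  rw [width]
  linarith

theorem abs_inner_sub_le_width {C : Set Plane} (hC : Bornology.IsBounded C) (θ : Real.Angle)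
    {x y : Plane} (hx : x ∈ C) (hy : y ∈ C) : |⟪x - y, u θ⟫| ≤ width C θ := by
  rw [inner_sub_left, abs_sub_le_iff]
  constructor <;> linarith [infInner_le hC θ hx, infInner_le hC θ hy,
    inner_le_infInner_add_width hC θ hx, inner_le_infInner_add_width hC θ hy]

theorem width_nonneg {C : Set Plane} (hC : Bornology.IsBounded C) (θ : Real.Angle) :
    0 ≤ width C θ := by
  rcases C.eq_empty_or_nonempty with rfl | ⟨x, hx⟩
  · simp [width, infInner, Real.iInf_of_isEmpty]
  · exact (abs_nonneg _).trans (abs_inner_sub_le_width hC θ hx hx)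

theorem chordLength_eq_zero {C : Set Plane} (hC : Bornology.IsBounded C) {θ : Real.Angle} {l : ℝ}
    (hl : l ∉ Icc 0 (width C θ)) : chordLength C θ l = 0 := by
  have chord_eq_empty : chord C θ l = ∅ := by
    refine eq_empty_of_forall_notMem fun x hx ↦ hl ?_
    have hxl : ⟪x, u θ⟫ = infInner C θ + l := hx.2
    exact ⟨by linarith [infInner_le hC θ hx.1],
      by linarith [inner_le_infInner_add_width hC θ hx.1]⟩
  rw [chordLength, chord_eq_empty, Metric.diam_empty]

theorem slice_nonempty {C : Set Plane} (hC : Convex ℝ C) {θ : Real.Angle} {l : ℝ}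
    (hl : l ∈ Ioo 0 (width C θ)) : (slice C θ (infInner C θ + l)).Nonempty := by
  have hne : Nonempty C := by
    by_contra h
    have : IsEmpty C := not_nonempty_iff.1 h
    have hw := hl.1.trans hl.2
    simp [width, infInner, Real.iInf_of_isEmpty] at hw
  obtain ⟨⟨x, hx⟩, hxl⟩ := exists_lt_of_ciInf_lt (lt_add_of_pos_right (infInner C θ) hl.1)
  obtain ⟨⟨y, hy⟩, hyl⟩ := exists_lt_of_ciInf_lt (f := fun y : C ↦ ⟪(y : Plane), u (θ + Real.pi)⟫)
    (a := -(infInner C θ + l)) (by change infInner _ _ < _; linarith [hl.2, width.eq_1 C θ])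
  rw [u_add_pi, inner_neg_right, neg_lt_neg_iff] at hyl
  have convex_values : Convex ℝ ((fun z : Plane ↦ ⟪z, u θ⟫) '' C) :=
    hC.is_linear_image ⟨fun a b ↦ inner_add_left _ _ _, fun a b ↦ real_inner_smul_left _ _ _⟩
  obtain ⟨z, hz, hzl⟩ := convex_values.ordConnected.out (mem_image_of_mem _ hx)
    (mem_image_of_mem _ hy) ⟨hxl.le, hyl.le⟩
  rw [← image_nonempty, ← setOf_inner_eq_image_slice]
  exact ⟨z, hz, hzl⟩

/-- The length of the chord at distance `l`, as a function of `l`. The possible chords on the two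
supporting lines are discarded: only those strictly between them are constrained by concavity. -/
def chordProfile (C : Set Plane) (θ : Real.Angle) : ℝ → ℝ :=
  (Ioo 0 (width C θ)).indicator (chordLength C θ)

theorem chordProfile_ae_eq {C : Set Plane} (hC : Bornology.IsBounded C) (θ : Real.Angle) :
    chordProfile C θ =ᵐ[volume] chordLength C θ := by
  filter_upwards [Measure.ae_ne volume 0, Measure.ae_ne volume (width C θ)] with l hl0 hlw
  by_cases hl : l ∈ Ioo 0 (width C θ)
  · exact indicator_of_mem hl _
  · rw [chordProfile, indicator_of_notMem hl, chordLength_eq_zero hC]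
    exact fun h ↦ hl ⟨h.1.lt_of_ne' hl0, h.2.lt_of_ne hlw⟩

theorem isConcaveProfile_chordProfile {C : Set Plane} (hC : Convex ℝ C)
    (hbdd : Bornology.IsBounded C) (θ : Real.Angle) :
    IsConcaveProfile (width C θ) (chordProfile C θ) where
  concaveOn := by
    refine ConcaveOn.congr ⟨convex_Ioo _ _, fun x hx y hy a b ha hb hab ↦ ?_⟩
      fun l hl ↦ (indicator_of_mem hl _).symm
    have slice_level : a * (infInner C θ + x) + b * (infInner C θ + y) =
        infInner C θ + (a * x + b * y) := by linear_combination infInner C θ * hab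
    simpa only [chordLength_eq_diam_slice, smul_eq_mul, slice_level] using
      diam_slice_concave hC hbdd θ (slice_nonempty hC hx) (slice_nonempty hC hy) ha hb hab
  nonneg t := indicator_nonneg (fun _ _ ↦ Metric.diam_nonneg) t
  eq_zero t ht := indicator_of_notMem ht _

theorem gamma_eq_endHeight {C : Set Plane} {θ : Real.Angle} {l : ℝ}
    (hl : l ∈ Ioo 0 (width C θ)) : gamma C θ l = endHeight (width C θ) (chordProfile C θ) l := by
  have hl' : width C θ - l ∈ Ioo 0 (width C θ) := ⟨sub_pos.2 hl.2, sub_lt_self _ hl.1⟩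
  rw [gamma, chordLength_add_pi, endHeight, chordProfile, indicator_of_mem hl,
    indicator_of_mem hl']

theorem norm_indicatorFourier_smul_u {C : Set Plane} (hC : Convex ℝ C)
    (hbdd : Bornology.IsBounded C) (θ : Real.Angle) (s : ℝ) :
    ‖indicatorFourier C (s • u θ)‖ = ‖𝓕 (fun t ↦ (chordProfile C θ t : ℂ)) s‖ := by
  have diam_slice (t : ℝ) :
      Metric.diam (slice C θ t) = chordLength C θ (t + -infInner C θ) := by
    rw [chordLength_eq_diam_slice, add_neg_cancel_comm_assoc]
  have profile_ae_eq : (fun l ↦ (chordProfile C θ l : ℂ)) =ᵐ[volume]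
      fun l ↦ (chordLength C θ l : ℂ) := (chordProfile_ae_eq hbdd θ).fun_comp ((↑) : ℝ → ℂ)
  simp only [indicatorFourier_smul_u hC hbdd, diam_slice]
  rw [fourier_comp_add_right (fun l ↦ (chordLength C θ l : ℂ)), Circle.norm_smul,
    Real.fourier_congr_ae profile_ae_eq]

theorem norm_indicatorFourier_smul_smul_u {C : Set Plane} (hC : Convex ℝ C)
    (hbdd : Bornology.IsBounded C) (θ : Real.Angle) (ρ : ℝ) {δ : ℝ} (hδ : δ ≠ 0) :
    ‖indicatorFourier (δ • C) (ρ • u θ)‖ =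
      δ ^ 2 * ‖𝓕 (fun t ↦ (chordProfile C θ t : ℂ)) (ρ * δ)‖ := by
  rw [indicatorFourier_smul C hδ, smul_smul, norm_smul, norm_pow, Real.norm_eq_abs, sq_abs,
    norm_indicatorFourier_smul_u hC hbdd, mul_comm δ]

theorem bddAbove_range_chordLength {C : Set Plane} (hC : Bornology.IsBounded C)
    (θ : Real.Angle) : BddAbove (range fun l : {l : ℝ // 0 ≤ l} ↦ chordLength C θ l) :=
  ⟨longDiam C, forall_mem_range.2 fun _ ↦ Metric.diam_mono (fun _ hx ↦ hx.1) hC⟩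

theorem shortDiam_le_of_forall_chordLength_le {C : Set Plane} {θ : Real.Angle} {d : ℝ}
    (h : ∀ l, chordLength C θ l ≤ d) : shortDiam C ≤ d := by
  have : Nonempty {l : ℝ // 0 ≤ l} := ⟨⟨0, le_rfl⟩⟩
  refine (ciInf_le (f := fun θ ↦ ⨆ l : {l : ℝ // 0 ≤ l}, chordLength C θ l) ⟨0, ?_⟩ θ).trans
    (ciSup_le fun l ↦ h l)
  exact forall_mem_range.2 fun φ ↦ Real.iSup_nonneg fun l ↦ Metric.diam_nonneg

theorem shortDiam_le_longDiam {C : Set Plane} (hC : Bornology.IsBounded C) :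
    shortDiam C ≤ longDiam C :=
  shortDiam_le_of_forall_chordLength_le (θ := 0) fun _ ↦ Metric.diam_mono (fun _ hx ↦ hx.1) hC

theorem shortDiam_le_width {C : Set Plane} (hC : Bornology.IsBounded C) (θ : Real.Angle) :
    shortDiam C ≤ width C θ := by
  refine shortDiam_le_of_forall_chordLength_le (θ := perp θ) fun l ↦
    Metric.diam_le_of_forall_dist_le (width_nonneg hC θ) fun x hx y hy ↦ ?_
  have hnorm : ‖x - y‖ ^ 2 = ⟪x - y, u θ⟫ ^ 2 := by
    rw [norm_sq_eq θ, inner_sub_left x y (u (perp θ)), hx.2, hy.2, sub_self, zero_pow two_ne_zero,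
      add_zero]
  rw [dist_eq_norm, ← abs_norm, (sq_eq_sq_iff_abs_eq_abs _ _).1 hnorm]
  exact abs_inner_sub_le_width hC θ hx.1 hy.1

theorem IsConvexBody.shortDiam_pos {C : Set Plane} (hC : IsConvexBody C) : 0 < shortDiam C := by
  obtain ⟨x, hx⟩ := hC.interior_nonempty
  obtain ⟨r, hr, hball⟩ := Metric.nhds_basis_closedBall.mem_iff.1 (mem_interior_iff_mem_nhds.1 hx)
  refine hr.trans_le (le_ciInf fun θ ↦ ?_)
  have hxC : x ∈ C := interior_subset hx
  set l := ⟪x, u θ⟫ - infInner C θ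
  have hl : 0 ≤ l := sub_nonneg.2 (infInner_le hC.isBounded θ hxC)
  have x_mem_chord : x ∈ chord C θ l := ⟨hxC, (add_sub_cancel _ _).symm⟩
  have dist_translate : dist (x + r • u (perp θ)) x = r := by
    rw [dist_self_add_left, norm_smul, norm_u, mul_one, Real.norm_of_nonneg hr.le]
  have translate_mem_chord : x + r • u (perp θ) ∈ chord C θ l := by
    refine ⟨hball (Metric.mem_closedBall.2 dist_translate.le), ?_⟩
    rw [inner_add_left, real_inner_smul_left, real_inner_comm (u θ) (u (perp θ)), inner_u_perp,
      mul_zero, add_zero]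
    exact x_mem_chord.2
  calc r = dist (x + r • u (perp θ)) x := dist_translate.symm
    _ ≤ chordLength C θ l := Metric.dist_le_diam_of_mem
        (hC.isBounded.subset fun _ h ↦ h.1) translate_mem_chord x_mem_chord
    _ ≤ ⨆ l : {l : ℝ // 0 ≤ l}, chordLength C θ l :=
        le_ciSup (bddAbove_range_chordLength hC.isBounded θ) ⟨l, hl⟩

theorem IsConvexBody.le_width_mul {C : Set Plane} (hC : IsConvexBody C) (θ : Real.Angle)
    {κ ρ : ℝ} (hκ : 0 ≤ κ) (hρ : κ * longDiam C ^ 6 / shortDiam C ^ 7 ≤ ρ) :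
    κ ≤ width C θ * ρ := by
  have hS := hC.shortDiam_pos
  have hρS : κ / shortDiam C ≤ ρ :=
    calc κ / shortDiam C = κ * shortDiam C ^ 6 / shortDiam C ^ 7 := by field_simp
      _ ≤ κ * longDiam C ^ 6 / shortDiam C ^ 7 := by
          gcongr
          exact shortDiam_le_longDiam hC.isBounded
      _ ≤ ρ := hρ
  have hρ0 : 0 ≤ ρ := (div_nonneg hκ hS.le).trans hρS
  calc κ ≤ shortDiam C * ρ := (div_le_iff₀' hS).1 hρS
    _ ≤ width C θ * ρ := mul_le_mul_of_nonneg_right (shortDiam_le_width hC.isBounded θ) hρ0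

end PlanarBody

open PlanarBody in
theorem lemma3p1_general {C : Set Plane} (hC : Convex ℝ C) (hbdd : Bornology.IsBounded C)
    (θ : Real.Angle) {ρ : ℝ} (hρ : 10 ≤ width C θ * ρ) :
    IntervalIntegrable (fun δ : ℝ ↦ ‖indicatorFourier (δ • C) (ρ • u θ)‖ ^ 2) volume 0 1 ∧
      (3 / 390625) ^ 2 * (ρ ^ 2)⁻¹ * gamma C θ ρ⁻¹ ^ 2 ≤
          ∫ δ in (0 : ℝ)..1, ‖indicatorFourier (δ • C) (ρ • u θ)‖ ^ 2 ∧
        ∫ δ in (0 : ℝ)..1, ‖indicatorFourier (δ • C) (ρ • u θ)‖ ^ 2 ≤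
          2 * (ρ ^ 2)⁻¹ * gamma C θ ρ⁻¹ ^ 2 := by
  have hf := isConcaveProfile_chordProfile hC hbdd θ
  have hρ0 : 0 < ρ := pos_of_mul_pos_right (by linarith) (width_nonneg hbdd θ)
  have hρw : ρ⁻¹ < width C θ := (inv_lt_iff_one_lt_mul₀ hρ0).2 (by linarith)
  have fourier_eqOn : EqOn
      (fun δ ↦ (δ ^ 2 * ‖𝓕 (fun t ↦ (chordProfile C θ t : ℂ)) (ρ * δ)‖) ^ 2)
      (fun δ ↦ ‖indicatorFourier (δ • C) (ρ • u θ)‖ ^ 2) (uIoc 0 1) := fun δ hδ ↦ by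
    rw [uIoc_of_le zero_le_one] at hδ
    simp only [norm_indicatorFourier_smul_smul_u hC hbdd θ ρ hδ.1.ne']
  have hcont : Continuous fun δ : ℝ ↦
      (δ ^ 2 * ‖𝓕 (fun t ↦ (chordProfile C θ t : ℂ)) (ρ * δ)‖) ^ 2 := by
    have := continuous_fourier (f := fun t ↦ (chordProfile C θ t : ℂ)) hf.integrable.ofReal
    fun_prop
  rw [gamma_eq_endHeight ⟨inv_pos.2 hρ0, hρw⟩,
    ← intervalIntegral.integral_congr_ae (ae_of_all _ fourier_eqOn)]
  exact ⟨(hcont.intervalIntegrable 0 1).congr fourier_eqOn,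
    hf.integral_sq_mul_norm_fourier_bounds hρ0 hρ⟩

end

theorem lemma3p1 :
    ∃ κ₃ κ₄ : ℝ, 0 < κ₃ ∧ 0 < κ₄ ∧
      ∀ C : Set PlanarBody.Plane, PlanarBody.IsConvexBody C →
        ∀ (θ : Real.Angle) (ρ : ℝ),
          κ₃ * PlanarBody.longDiam C ^ 6 / PlanarBody.shortDiam C ^ 7 ≤ ρ →
            IntervalIntegrable
                (fun δ : ℝ => ‖PlanarBody.indicatorFourier (δ • C) (ρ • PlanarBody.u θ)‖ ^ 2)
                MeasureTheory.volume 0 1 ∧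
              κ₄ * (ρ ^ 2)⁻¹ * PlanarBody.gamma C θ ρ⁻¹ ^ 2 ≤
                  ∫ δ in (0 : ℝ)..1,
                    ‖PlanarBody.indicatorFourier (δ • C) (ρ • PlanarBody.u θ)‖ ^ 2 ∧
                ∫ δ in (0 : ℝ)..1,
                    ‖PlanarBody.indicatorFourier (δ • C) (ρ • PlanarBody.u θ)‖ ^ 2 ≤
                  2 * (ρ ^ 2)⁻¹ * PlanarBody.gamma C θ ρ⁻¹ ^ 2 :=
  ⟨10, (3 / 390625) ^ 2, by norm_num, by norm_num, fun _ hC θ _ hρ ↦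
    lemma3p1_general hC.convex hC.isBounded θ (hC.le_width_mul θ (by norm_num) hρ)⟩
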